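/- Let $\mathbb{Z}^2$ denote the square integer lattice: the graph with vertex set $\mathbb{Z}^2$ in which two vertices are joined by an edge when their Euclidean distance is $1$. Fix a vertex $v_0$ (by vertex-transitivity the choice does not matter). In the $(p,q)$-percolation game on $\mathbb{Z}^2$, two players, Maker and Breaker, play in alternating turns, with Maker playing first. Initially all edges are marked as unsafe. On each of her turns Maker marks $p$ unsafe edges as safe; on each of his turns Breaker chooses $q$ unsafe edges and deletes them from the graph. Breaker wins if at some time in the game the connected component of $v_0$ in the remaining graph is finite. **Theorem.** Let $p,q$ be positive integers. If $q \geqslant 2p$, then Breaker has a winning strategy for the $(p,q)$-percolation game on $\mathbb{Z}^2$. -/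

import Mathlib

/-- The square integer lattice: the vertex set is `ℤ × ℤ`, and two vertices are adjacent when
their Euclidean distance (equivalently, its square) is equal to `1`. -/
def squareLattice : SimpleGraph (ℤ × ℤ) where
  Adj v w := (v.1 - w.1) ^ 2 + (v.2 - w.2) ^ 2 = 1
  symm := ⟨fun v w h => by
    have h' : (v.1 - w.1) ^ 2 + (v.2 - w.2) ^ 2 = 1 := h
    change (w.1 - v.1) ^ 2 + (w.2 - v.2) ^ 2 = 1
    rw [← h']; ring⟩
  loopless := ⟨fun v h => by simp at h⟩

namespace PercolationGame

/-- A completed round of the game: the set of edges that Maker marked as safe on her turn,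
followed by the set of edges that Breaker deleted on his turn. -/
abbrev Round (V : Type*) := Finset (Sym2 V) × Finset (Sym2 V)

/-- The edges that Maker has marked as safe in the rounds of the history `h`. -/
def safeEdges {V : Type*} (h : List (Round V)) : Set (Sym2 V) :=
  {e | ∃ r ∈ h, e ∈ r.1}

/-- The edges that Breaker has deleted in the rounds of the history `h`. -/
def deletedEdges {V : Type*} (h : List (Round V)) : Set (Sym2 V) :=
  {e | ∃ r ∈ h, e ∈ r.2}

/-- The edges of `G` that are still unclaimed (neither marked as safe nor deleted) after the
rounds of the history `h`. -/
def unclaimedEdges {V : Type*} (G : SimpleGraph V) (h : List (Round V)) : Set (Sym2 V) :=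
  G.edgeSet \ (safeEdges h ∪ deletedEdges h)

/-- `m` is a legal turn for Maker after the rounds of `h`: she marks exactly `p` unclaimed edges
as safe. -/
def IsMakerMove {V : Type*} (G : SimpleGraph V) (p : ℕ) (h : List (Round V))
    (m : Finset (Sym2 V)) : Prop :=
  m.card = p ∧ (m : Set (Sym2 V)) ⊆ unclaimedEdges G h

/-- `b` is a legal turn for Breaker after the rounds of `h` and Maker's turn `m`: he deletes
exactly `q` edges that are still unclaimed. -/
def IsBreakerMove {V : Type*} (G : SimpleGraph V) (q : ℕ) (h : List (Round V))
    (m b : Finset (Sym2 V)) : Prop :=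
  b.card = q ∧ (b : Set (Sym2 V)) ⊆ unclaimedEdges G h \ (m : Set (Sym2 V))

/-- After the rounds of `h`, the component of `v₀` in the graph left after Breaker's deletions
is finite. -/
def BreakerHasWon {V : Type*} (G : SimpleGraph V) (v₀ : V) (h : List (Round V)) : Prop :=
  ((G.deleteEdges (deletedEdges h)).connectedComponentMk v₀).supp.Finite

/-- A strategy for Breaker: given the completed rounds (in chronological order) and the turn that
Maker has just played, it names the set of edges that Breaker deletes in answer. -/
abbrev BreakerStrategy (V : Type*) := List (Round V) → Finset (Sym2 V) → Finset (Sym2 V)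

/-- The history of the first `n` rounds, when Maker plays `m 0, m 1, …` on her successive turns
and Breaker follows the strategy `σ`. -/
def history {V : Type*} (σ : BreakerStrategy V) (m : ℕ → Finset (Sym2 V)) : ℕ → List (Round V)
  | 0 => []
  | n + 1 => history σ m n ++ [(m n, σ (history σ m n) (m n))]

/-- `σ` is a winning strategy for Breaker in the `(p, q)`-percolation game on the infinite
connected graph `G` with root `v₀`: against every legal play of Maker, all the turns that `σ`
prescribes are legal, and at some time the component of `v₀` becomes finite.

Since `G` has infinitely many edges, each player always has a legal turn; since components only
shrink and only on Breaker's turns, it suffices to look at the position at the end of each round,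
and it does not matter that the play formally goes on after Breaker has won. -/
def IsWinningForBreaker {V : Type*} (G : SimpleGraph V) (v₀ : V) (p q : ℕ)
    (σ : BreakerStrategy V) : Prop :=
  ∀ m : ℕ → Finset (Sym2 V),
    (∀ n, (∀ k ≤ n, IsMakerMove G p (history σ m k) (m k)) →
      IsBreakerMove G q (history σ m n) (m n) (σ (history σ m n) (m n))) ∧
    ((∀ n, IsMakerMove G p (history σ m n) (m n)) →
      ∃ n, BreakerHasWon G v₀ (history σ m n))

/-- Breaker has a winning strategy in the `(p, q)`-percolation game on `(G, v₀)`. -/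
def BreakerWins {V : Type*} (G : SimpleGraph V) (v₀ : V) (p q : ℕ) : Prop :=
  ∃ σ : BreakerStrategy V, IsWinningForBreaker G v₀ p q σ

end PercolationGame

/-! Breaker deletes only edges that leave the finite cluster `V` joined to `v₀` by safe edges.
Counting the four edges at each vertex of `V`, and using `2 * p ≤ q`, gives exits + cycle rank + 2 *
waste ≤ 4 after every round (`IsPosition.card_exits_add_le`). This alone does not end the game:
Breaker must choose well which exits to leave open.

He leaves those that are hard to pass without closing a cycle. The cycle rank never drops, and while
it is constant `V` grows by pendant trees (`IsCluster.growth`). Following the unit square to the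
left of an exit through such growth leads injectively to a new exit (`nextExit`), whose weight is at
least 5 times the old one if the old exit was used (`weight_le_weight_nextExit`). Weights are 1, 5
or 25, so the bound on `n` in `HasProgress` is itself bounded. Every round raises it: a cycle
appears, an exit becomes heavier, or the cluster stands still and waste grows. Hence Breaker wins
within 808 rounds. -/

namespace PercolationGame

/-- The four unit steps of the square lattice. -/
def steps : Finset (ℤ × ℤ) := {(1, 0), (0, 1), (-1, 0), (0, -1)}

lemma squareLattice_adj_iff {u v : ℤ × ℤ} : squareLattice.Adj u v ↔ v - u ∈ steps := by
  obtain ⟨a, b⟩ := u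
  obtain ⟨c, d⟩ := v
  change (a - c) ^ 2 + (b - d) ^ 2 = 1 ↔ _
  simp only [steps, Prod.mk_sub_mk, Finset.mem_insert, Finset.mem_singleton, Prod.mk.injEq]
  constructor
  · intro h
    have h1 : -1 ≤ c - a := by nlinarith [sq_nonneg (b - d)]
    have h2 : c - a ≤ 1 := by nlinarith [sq_nonneg (b - d)]
    have h3 : -1 ≤ d - b := by nlinarith [sq_nonneg (a - c)]
    have h4 : d - b ≤ 1 := by nlinarith [sq_nonneg (a - c)]
    have hx : a - c = -(c - a) := by ring
    have hy : b - d = -(d - b) := by ring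
    rw [hx, hy] at h
    generalize c - a = x at *
    generalize d - b = y at *
    interval_cases x <;> interval_cases y <;> simp_all
  · rintro (⟨h, h'⟩ | ⟨h, h'⟩ | ⟨h, h'⟩ | ⟨h, h'⟩) <;>
    · have hx : a - c = -(c - a) := by ring
      have hy : b - d = -(d - b) := by ring
      rw [hx, hy, h, h']
      norm_num

/-! ### Clusters of safe edges -/

/-- `V` is the set of vertices joined to `v₀` by edges of `S`. -/
def IsCluster (v₀ : ℤ × ℤ) (S : Finset (Sym2 (ℤ × ℤ))) (V : Finset (ℤ × ℤ)) : Prop :=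
  ∀ x, x ∈ V ↔ (SimpleGraph.fromEdgeSet (S : Set (Sym2 (ℤ × ℤ)))).Reachable v₀ x

namespace IsCluster

variable {v₀ : ℤ × ℤ} {S S' : Finset (Sym2 (ℤ × ℤ))} {V V' : Finset (ℤ × ℤ)}

lemma root_mem (h : IsCluster v₀ S V) : v₀ ∈ V := (h v₀).2 (SimpleGraph.Reachable.refl _)

lemma mem_of_edge (h : IsCluster v₀ S V) {x y : ℤ × ℤ} (hx : x ∈ V) (hxy : s(x, y) ∈ S) :
    y ∈ V := by
  by_cases hne : x = y
  · exact hne ▸ hx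
  · refine (h y).2 (((h x).1 hx).trans (SimpleGraph.Adj.reachable ?_))
    simpa [SimpleGraph.fromEdgeSet_adj, hne] using hxy

lemma subset (h : IsCluster v₀ S V) (h' : IsCluster v₀ S' V') (hS : S ⊆ S') : V ⊆ V' := by
  intro x hx
  refine (h' x).2 (((h x).1 hx).mono ?_)
  exact SimpleGraph.fromEdgeSet_mono (by exact_mod_cast hS)

/-- Every vertex of a cluster other than the root has a parent edge, and distinct vertices have
distinct parent edges. -/
lemma exists_parent (h : IsCluster v₀ S V) :
    ∃ f : ℤ × ℤ → ℤ × ℤ, (∀ x ∈ V, x ≠ v₀ → f x ∈ V ∧ s(x, f x) ∈ S) ∧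
      ∀ x ∈ V, ∀ y ∈ V, x ≠ v₀ → y ≠ v₀ → s(x, f x) = s(y, f y) → x = y := by
  set H := SimpleGraph.fromEdgeSet (S : Set (Sym2 (ℤ × ℤ))) with hH
  have key : ∀ x, ∃ y, x ∈ V → x ≠ v₀ → (y ∈ V ∧ s(x, y) ∈ S) ∧ H.dist v₀ x = H.dist v₀ y + 1 := by
    intro x
    by_cases hx : x ∈ V
    swap
    · exact ⟨x, fun h' => absurd h' hx⟩
    by_cases hx0 : x = v₀
    · exact ⟨x, fun _ h' => absurd hx0 h'⟩
    -- The parent of `x` is the second vertex of a shortest walk to the root.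
    obtain ⟨w, hw⟩ : ∃ w : H.Walk x v₀, w.length = H.dist x v₀ :=
      ((h x).1 hx).symm.exists_walk_length_eq_dist
    cases w with
    | nil => exact absurd rfl hx0
    | @cons _ y _ hadj w =>
      refine ⟨y, fun _ _ => ?_⟩
      have hyr : H.Reachable v₀ y := ((h x).1 hx).trans hadj.reachable
      have hS : s(x, y) ∈ S := by
        have := hadj
        rw [SimpleGraph.fromEdgeSet_adj] at this
        exact_mod_cast this.1
      refine ⟨⟨(h y).2 hyr, hS⟩, ?_⟩
      have h1 : H.dist y v₀ ≤ w.length := SimpleGraph.dist_le w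
      have h2 : H.dist x v₀ ≤ H.dist y v₀ + 1 := by
        obtain ⟨w', hw'⟩ := hyr.symm.exists_walk_length_eq_dist
        have h3 : H.dist x v₀ ≤ _ := SimpleGraph.dist_le (SimpleGraph.Walk.cons hadj w')
        rw [SimpleGraph.Walk.length_cons, hw'] at h3
        exact h3
      simp only [SimpleGraph.Walk.length_cons] at hw
      rw [SimpleGraph.dist_comm (u := v₀) (v := x), SimpleGraph.dist_comm (u := v₀) (v := y)]
      omega
  choose f hf using key
  refine ⟨f, fun x hx hx0 => (hf x hx hx0).1, fun x hx y hy hx0 hy0 hxy => ?_⟩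
  -- Distinct vertices with the same parent edge would be each other's parents, each farther from
  -- the root than the other.
  rcases Sym2.eq_iff.1 hxy with h1 | ⟨h1, h2⟩
  · exact h1.1
  · have e1 := (hf x hx hx0).2
    have e2 := (hf y hy hy0).2
    rw [h2] at e1
    rw [← h1] at e2
    omega

/-- A path leaving a smaller cluster crosses its boundary. -/
lemma exists_crossing (h : IsCluster v₀ S V) (h' : IsCluster v₀ S' V') (hne : ¬ V' ⊆ V) :
    ∃ u v, u ∈ V ∧ v ∈ V' ∧ v ∉ V ∧ s(u, v) ∈ S' := by
  by_contra! hcon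
  refine hne fun x hx => ?_
  obtain ⟨w⟩ := (h' x).1 hx
  have key : ∀ a b : ℤ × ℤ, (SimpleGraph.fromEdgeSet (S' : Set (Sym2 (ℤ × ℤ)))).Walk a b →
      a ∈ V → a ∈ V' → b ∈ V := by
    intro a b w
    induction w with
    | nil => exact fun ha _ => ha
    | @cons a c b hadj w ih =>
      intro ha ha'
      have hS : s(a, c) ∈ S' := by
        rw [SimpleGraph.fromEdgeSet_adj] at hadj
        exact_mod_cast hadj.1
      have hc := h'.mem_of_edge ha' hS
      by_cases hcV : c ∈ V
      · exact ih hcV hc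
      · exact absurd hS (hcon a c ha hc hcV)
  exact key _ _ w h.root_mem h'.root_mem

end IsCluster

lemma exists_isCluster (v₀ : ℤ × ℤ) (S : Finset (Sym2 (ℤ × ℤ))) : ∃ V, IsCluster v₀ S V := by
  have hfin : {x | (SimpleGraph.fromEdgeSet (S : Set (Sym2 (ℤ × ℤ)))).Reachable v₀ x}.Finite := by
    refine ((S.biUnion Sym2.toFinset ∪ {v₀}).finite_toSet).subset ?_
    rintro x ⟨w⟩
    obtain ⟨w⟩ : Nonempty ((SimpleGraph.fromEdgeSet (S : Set (Sym2 (ℤ × ℤ)))).Walk x v₀) :=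
      ⟨w.reverse⟩
    cases w with
    | nil => simp
    | @cons _ y _ hadj w =>
      rw [SimpleGraph.fromEdgeSet_adj] at hadj
      have : s(x, y) ∈ S := by exact_mod_cast hadj.1
      simp only [Finset.coe_union, Finset.coe_singleton, Set.mem_union, Finset.mem_coe,
        Finset.mem_biUnion]
      exact Or.inl ⟨s(x, y), this, by simp⟩
  exact ⟨hfin.toFinset, fun x => by simp⟩

/-! ### Counting induced and boundary edges -/

/-- The directed lattice edges with both endpoints in `V`. -/
def innerDarts (V : Finset (ℤ × ℤ)) : Finset ((ℤ × ℤ) × (ℤ × ℤ)) :=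
  (V ×ˢ V).filter fun a => a.2 - a.1 ∈ steps

/-- The directed lattice edges from `V` to its complement. -/
def outDarts (V : Finset (ℤ × ℤ)) : Finset ((ℤ × ℤ) × (ℤ × ℤ)) :=
  ((V ×ˢ steps).image fun a => (a.1, a.1 + a.2)).filter fun a => a.2 ∉ V

/-- The directed lattice edges from `V` to its complement that are not in `D`. -/
def exits (V : Finset (ℤ × ℤ)) (D : Finset (Sym2 (ℤ × ℤ))) : Finset ((ℤ × ℤ) × (ℤ × ℤ)) :=
  (outDarts V).filter fun a => s(a.1, a.2) ∉ D

/-- The lattice edges with both endpoints in `V`. -/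
def innerEdges (V : Finset (ℤ × ℤ)) : Finset (Sym2 (ℤ × ℤ)) :=
  (innerDarts V).image fun a => s(a.1, a.2)

lemma mem_innerDarts {V : Finset (ℤ × ℤ)} {u v : ℤ × ℤ} :
    (u, v) ∈ innerDarts V ↔ u ∈ V ∧ v ∈ V ∧ squareLattice.Adj u v := by
  simp [innerDarts, squareLattice_adj_iff, and_assoc]

lemma mem_outDarts {V : Finset (ℤ × ℤ)} {u v : ℤ × ℤ} :
    (u, v) ∈ outDarts V ↔ u ∈ V ∧ v ∉ V ∧ squareLattice.Adj u v := by
  simp only [outDarts, Finset.mem_filter, Finset.mem_image, Finset.mem_product, Prod.exists,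
    Prod.mk.injEq, squareLattice_adj_iff]
  constructor
  · rintro ⟨⟨a, b, c, d, ⟨h1, h2⟩, rfl, rfl⟩, h3⟩
    exact ⟨h1, h3, by simpa using h2⟩
  · rintro ⟨h1, h2, h3⟩
    exact ⟨⟨u.1, u.2, (v - u).1, (v - u).2, ⟨h1, h3⟩, rfl, by ext <;> simp⟩, h2⟩

lemma mem_exits {V : Finset (ℤ × ℤ)} {D : Finset (Sym2 (ℤ × ℤ))} {u v : ℤ × ℤ} :
    (u, v) ∈ exits V D ↔ u ∈ V ∧ v ∉ V ∧ squareLattice.Adj u v ∧ s(u, v) ∉ D := by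
  simp [exits, mem_outDarts, and_assoc]

lemma mk_mem_innerEdges {V : Finset (ℤ × ℤ)} {u v : ℤ × ℤ} :
    s(u, v) ∈ innerEdges V ↔ u ∈ V ∧ v ∈ V ∧ squareLattice.Adj u v := by
  constructor
  · intro h
    obtain ⟨⟨a, b⟩, hab, he⟩ := Finset.mem_image.1 h
    rw [mem_innerDarts] at hab
    rcases Sym2.eq_iff.1 he with ⟨rfl, rfl⟩ | ⟨rfl, rfl⟩
    · exact hab
    · exact ⟨hab.2.1, hab.1, hab.2.2.symm⟩
  · exact fun h => Finset.mem_image.2 ⟨(u, v), mem_innerDarts.2 h, rfl⟩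

lemma card_innerDarts (V : Finset (ℤ × ℤ)) : (innerDarts V).card = 2 * (innerEdges V).card := by
  rw [Finset.card_eq_sum_card_fiberwise (f := fun a => s(a.1, a.2)) (t := innerEdges V)
    (fun a ha => Finset.mem_coe.2 (Finset.mem_image_of_mem _ ha))]
  rw [Finset.sum_const_nat (m := 2), mul_comm]
  intro e
  refine Sym2.ind (fun u v he => ?_) e
  rw [mk_mem_innerEdges] at he
  have : (innerDarts V).filter (fun a => s(a.1, a.2) = s(u, v)) = {(u, v), (v, u)} := by
    ext ⟨a, b⟩
    simp only [Finset.mem_filter, mem_innerDarts, Sym2.eq_iff, Finset.mem_insert,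
      Finset.mem_singleton, Prod.mk.injEq]
    constructor
    · exact fun h => h.2
    · rintro (⟨rfl, rfl⟩ | ⟨rfl, rfl⟩)
      · exact ⟨he, by simp⟩
      · exact ⟨⟨he.2.1, he.1, he.2.2.symm⟩, by simp⟩
  rw [this, Finset.card_pair]
  intro h
  rw [Prod.mk.injEq] at h
  exact he.2.2.ne h.1

/-- The lattice is 4-regular, and an induced edge is seen from both of its ends. -/
lemma two_mul_card_innerEdges_add_card_outDarts (V : Finset (ℤ × ℤ)) :
    2 * (innerEdges V).card + (outDarts V).card = 4 * V.card := by
  have h1 : innerDarts V =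
      ((V ×ˢ steps).image fun a => (a.1, a.1 + a.2)).filter fun a => a.2 ∈ V := by
    ext ⟨u, v⟩
    simp only [mem_innerDarts, Finset.mem_filter, Finset.mem_image, Finset.mem_product,
      Prod.exists, Prod.mk.injEq, squareLattice_adj_iff]
    constructor
    · rintro ⟨h1, h2, h3⟩
      exact ⟨⟨u.1, u.2, (v - u).1, (v - u).2, ⟨h1, h3⟩, rfl, by ext <;> simp⟩, h2⟩
    · rintro ⟨⟨a, b, c, d, ⟨h1, h2⟩, rfl, rfl⟩, h3⟩
      exact ⟨h1, h3, by simpa using h2⟩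
  rw [← card_innerDarts, h1, outDarts, Finset.card_filter_add_card_filter_not,
    Finset.card_image_of_injective, Finset.card_product, mul_comm]
  · rfl
  · rintro ⟨a, b⟩ ⟨c, d⟩ h
    simp only [Prod.mk.injEq] at h
    obtain ⟨rfl, h⟩ := h
    simpa using h

/-- The orientation can be recovered: the tail is the endpoint in `V`. -/
lemma outDarts_mk_injOn (V : Finset (ℤ × ℤ)) :
    Set.InjOn (fun a : (ℤ × ℤ) × (ℤ × ℤ) => s(a.1, a.2)) (outDarts V) := by
  rintro ⟨a, b⟩ h1 ⟨c, d⟩ h2 h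
  rw [Finset.mem_coe, mem_outDarts] at h1 h2
  rcases Sym2.eq_iff.1 h with ⟨rfl, rfl⟩ | ⟨rfl, rfl⟩
  · rfl
  · exact absurd h1.1 h2.2.1

lemma innerEdges_mono {V V' : Finset (ℤ × ℤ)} (h : V ⊆ V') : innerEdges V ⊆ innerEdges V' := by
  intro e
  refine Sym2.ind (fun u v he => ?_) e
  rw [mk_mem_innerEdges] at he ⊢
  exact ⟨h he.1, h he.2.1, he.2.2⟩

namespace IsCluster

variable {v₀ : ℤ × ℤ} {S S' : Finset (Sym2 (ℤ × ℤ))} {V V' : Finset (ℤ × ℤ)}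

/-- Parent edges inject the non-root vertices into the safe induced edges; the `+ 1` is the root. -/
lemma card_le_card_inner_safe (h : IsCluster v₀ S V)
    (hS : ∀ e ∈ S, e ∈ squareLattice.edgeSet) :
    V.card ≤ (S ∩ innerEdges V).card + 1 := by
  obtain ⟨f, hf, hinj⟩ := h.exists_parent
  have : (V.erase v₀).card ≤ (S ∩ innerEdges V).card := by
    refine Finset.card_le_card_of_injOn (fun x => s(x, f x)) ?_ ?_
    · intro x hx
      rw [Finset.mem_coe, Finset.mem_erase] at hx
      have := hf x hx.2 hx.1
      exact Finset.mem_coe.2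
        (Finset.mem_inter.2 ⟨this.2, mk_mem_innerEdges.2 ⟨hx.2, this.1, hS _ this.2⟩⟩)
    · intro x hx y hy hxy
      rw [Finset.mem_coe, Finset.mem_erase] at hx hy
      exact hinj x hx.2 y hy.2 hx.1 hy.1 hxy
  rw [Finset.card_erase_of_mem h.root_mem] at this
  omega

lemma card_le (h : IsCluster v₀ S V) (hS : ∀ e ∈ S, e ∈ squareLattice.edgeSet) :
    V.card ≤ S.card + 1 :=
  (h.card_le_card_inner_safe hS).trans
    (Nat.add_le_add_right (Finset.card_le_card Finset.inter_subset_left) 1)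

/-- When a cluster grows, the number of induced edges grows at least as much as the number of
vertices; in case of equality, the new induced edges are exactly the parent edges of the new
vertices. -/
lemma growth (h : IsCluster v₀ S V) (h' : IsCluster v₀ S' V') (hSS : S ⊆ S')
    (hS : ∀ e ∈ S', e ∈ squareLattice.edgeSet) :
    (innerEdges V).card + V'.card ≤ (innerEdges V').card + V.card ∧
    ((innerEdges V').card + V.card ≤ (innerEdges V).card + V'.card →
      ∃ f : ℤ × ℤ → ℤ × ℤ, ∀ u v, u ∈ V' → v ∈ V' → squareLattice.Adj u v →
        (u ∈ V ∧ v ∈ V) ∨ (u ∉ V ∧ v = f u) ∨ (v ∉ V ∧ u = f v)) := by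
  obtain ⟨f, hf, hinj⟩ := h'.exists_parent
  have hsub := h.subset h' hSS
  have hne : ∀ x, x ∉ V → x ≠ v₀ := fun x hx he => hx (he ▸ h.root_mem)
  have himg : (V' \ V).image (fun x => s(x, f x)) ⊆ innerEdges V' \ innerEdges V := by
    intro e he
    obtain ⟨x, hx, rfl⟩ := Finset.mem_image.1 he
    rw [Finset.mem_sdiff] at hx
    have := hf x hx.1 (hne x hx.2)
    rw [Finset.mem_sdiff, mk_mem_innerEdges, mk_mem_innerEdges]
    exact ⟨⟨hx.1, this.1, hS _ this.2⟩, fun h => hx.2 h.1⟩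
  have hcard : ((V' \ V).image (fun x => s(x, f x))).card = (V' \ V).card := by
    refine Finset.card_image_of_injOn ?_
    intro x hx y hy hxy
    rw [Finset.mem_coe, Finset.mem_sdiff] at hx hy
    exact hinj x hx.1 y hy.1 (hne x hx.2) (hne y hy.2) hxy
  have c1 := Finset.card_sdiff_add_card_eq_card hsub
  have c2 := Finset.card_sdiff_add_card_eq_card (innerEdges_mono hsub)
  have c3 := Finset.card_le_card himg
  refine ⟨by omega, fun hle => ⟨f, fun u v hu hv huv => ?_⟩⟩
  -- The count is tight, so parent edges of new vertices exhaust the new induced edges.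
  have heq := Finset.eq_of_subset_of_card_le himg (by omega)
  by_cases huv' : u ∈ V ∧ v ∈ V
  · exact Or.inl huv'
  · have : s(u, v) ∈ innerEdges V' \ innerEdges V := by
      rw [Finset.mem_sdiff, mk_mem_innerEdges, mk_mem_innerEdges]
      exact ⟨⟨hu, hv, huv⟩, fun h => huv' ⟨h.1, h.2.1⟩⟩
    rw [← heq] at this
    obtain ⟨x, hx, hxe⟩ := Finset.mem_image.1 this
    rw [Finset.mem_sdiff] at hx
    rcases Sym2.eq_iff.1 hxe with ⟨rfl, rfl⟩ | ⟨rfl, rfl⟩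
    · exact Or.inr (Or.inl ⟨hx.2, rfl⟩)
    · exact Or.inr (Or.inr ⟨hx.2, rfl⟩)

/-- The basic count: the boundary of a cluster that is not deleted is small when many edges that
touch the cluster have been deleted. -/
lemma card_exits_add_le {D : Finset (Sym2 (ℤ × ℤ))} (h : IsCluster v₀ S V)
    (hS : ∀ e ∈ S, e ∈ squareLattice.edgeSet) (hD : ∀ e ∈ D, e ∈ squareLattice.edgeSet)
    (hSD : Disjoint S D) (htouch : ∀ e ∈ D, ∃ x ∈ V, x ∈ e) :
    (exits V D).card + (innerEdges V).card + D.card ≤ 3 * V.card + 1 := by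
  have h1 := two_mul_card_innerEdges_add_card_outDarts V
  have h2 := h.card_le_card_inner_safe hS
  -- Safe edges already occupy at least `V.card - 1` induced edges, which limits how many deletions
  -- lie inside `V` instead of closing exits.
  have h3 : (S ∩ innerEdges V).card + (D ∩ innerEdges V).card ≤ (innerEdges V).card := by
    rw [← Finset.card_union_of_disjoint]
    · exact Finset.card_le_card
        (Finset.union_subset Finset.inter_subset_right Finset.inter_subset_right)
    · exact Finset.disjoint_of_subset_left Finset.inter_subset_left
        (Finset.disjoint_of_subset_right Finset.inter_subset_left hSD)
  have h4 : (exits V D).card + ((outDarts V).filter fun a => s(a.1, a.2) ∈ D).card =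
      (outDarts V).card := by
    rw [exits, add_comm, Finset.card_filter_add_card_filter_not]
  have h5 : (D \ innerEdges V).card ≤ ((outDarts V).filter fun a => s(a.1, a.2) ∈ D).card := by
    refine (Finset.card_le_card (t := ((outDarts V).filter fun a => s(a.1, a.2) ∈ D).image
      (fun a => s(a.1, a.2))) ?_).trans Finset.card_image_le
    intro e he
    rw [Finset.mem_sdiff] at he
    obtain ⟨x, hxV, y, rfl⟩ := htouch e he.1
    have hadj : squareLattice.Adj x y := hD _ he.1
    refine Finset.mem_image.2 ⟨(x, y), Finset.mem_filter.2 ⟨mem_outDarts.2 ⟨hxV, ?_, hadj⟩, he.1⟩,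
      rfl⟩
    exact fun hy => he.2 (mk_mem_innerEdges.2 ⟨hxV, hy, hadj⟩)
  have h6 := Finset.card_inter_add_card_sdiff D (innerEdges V)
  omega

end IsCluster

end PercolationGame

/-! ### Exits, unit squares and weights -/

namespace PercolationGame

/-- The vertex that follows `u`, `v` on the unit square to the left of the directed edge from `u`
to `v`. -/
def third (u v : ℤ × ℤ) : ℤ × ℤ := (v.1 - (v.2 - u.2), v.2 + (v.1 - u.1))

/-- The vertex that precedes `u`, `v` on the unit square to the left of the directed edge from `u`
to `v`. -/
def fourth (u v : ℤ × ℤ) : ℤ × ℤ := (u.1 - (v.2 - u.2), u.2 + (v.1 - u.1))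

lemma third_third (u v : ℤ × ℤ) : third v (third u v) = fourth u v := by
  ext <;> simp only [third, fourth] <;> ring

lemma fourth_third (u v : ℤ × ℤ) : fourth v (third u v) = u := by
  ext <;> simp only [third, fourth] <;> ring

lemma third_fourth (u v : ℤ × ℤ) : third (third u v) (fourth u v) = u := by
  ext <;> simp only [third, fourth] <;> ring

lemma fourth_fourth (u v : ℤ × ℤ) : fourth (third u v) (fourth u v) = v := by
  ext <;> simp only [third, fourth] <;> ring

lemma adj_third {u v : ℤ × ℤ} (h : squareLattice.Adj u v) : squareLattice.Adj v (third u v) := by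
  change (u.1 - v.1) ^ 2 + (u.2 - v.2) ^ 2 = 1 at h
  change (v.1 - (v.1 - (v.2 - u.2))) ^ 2 + (v.2 - (v.2 + (v.1 - u.1))) ^ 2 = 1
  linear_combination h

lemma third_ne {u v : ℤ × ℤ} (h : squareLattice.Adj u v) : third u v ≠ u := by
  intro he
  apply h.ne
  simp only [third, Prod.ext_iff] at he
  ext <;> linarith [he.1, he.2]

/-- The weight of an exit: it grows with the number of vertices of `V` on the square to its left. -/
def weight (V : Finset (ℤ × ℤ)) (a : (ℤ × ℤ) × (ℤ × ℤ)) : ℕ :=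
  5 ^ ((if third a.1 a.2 ∈ V then 1 else 0) + (if fourth a.1 a.2 ∈ V then 1 else 0))

lemma one_le_weight (V : Finset (ℤ × ℤ)) (a : (ℤ × ℤ) × (ℤ × ℤ)) : 1 ≤ weight V a :=
  Nat.one_le_pow _ _ (by norm_num)

lemma weight_le (V : Finset (ℤ × ℤ)) (a : (ℤ × ℤ) × (ℤ × ℤ)) : weight V a ≤ 25 := by
  unfold weight
  split_ifs <;> norm_num

/-- The first exit from `V'` on the square to the left of `a`. -/
def nextExit (V' : Finset (ℤ × ℤ)) (a : (ℤ × ℤ) × (ℤ × ℤ)) : (ℤ × ℤ) × (ℤ × ℤ) :=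
  if a.2 ∉ V' then a
  else if third a.1 a.2 ∉ V' then (a.2, third a.1 a.2)
  else (third a.1 a.2, fourth a.1 a.2)

/-- `V'` arises from `V` by attaching pendant trees, with `f` as parent function. -/
def IsTreeGrowth (V V' : Finset (ℤ × ℤ)) (f : ℤ × ℤ → ℤ × ℤ) : Prop :=
  ∀ u v, u ∈ V' → v ∈ V' → squareLattice.Adj u v →
    (u ∈ V ∧ v ∈ V) ∨ (u ∉ V ∧ v = f u) ∨ (v ∉ V ∧ u = f v)

section NextExit

variable {V V' : Finset (ℤ × ℤ)} {f : ℤ × ℤ → ℤ × ℤ} {u v : ℤ × ℤ}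

/-- An edge from the new vertex `v` into `V` can only be the parent edge of `v`, which already leads
to `u`. -/
lemma third_notMem (hf : IsTreeGrowth V V' f) (hV : V ⊆ V') (hu : u ∈ V) (hv : v ∉ V)
    (hv' : v ∈ V') (hadj : squareLattice.Adj u v) : third u v ∉ V := by
  intro hx
  have h1 : u = f v := by
    rcases hf u v (hV hu) hv' hadj with h | h | h
    · exact absurd h.2 hv
    · exact absurd hu h.1
    · exact h.2
  rcases hf v _ hv' (hV hx) (adj_third hadj) with h | h | h
  · exact hv h.1
  · exact third_ne hadj (h.2.trans h1.symm)
  · exact h.1 hx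

/-- Were the whole square in `V'`, parents would run from `fourth u v` through `third u v` and `v`
to `u`, and the edge joining `fourth u v` to `u` would be no parent edge: it would close a cycle. -/
lemma fourth_notMem (hf : IsTreeGrowth V V' f) (hV : V ⊆ V') (hu : u ∈ V) (hv : v ∉ V)
    (hv' : v ∈ V') (hadj : squareLattice.Adj u v) (hx' : third u v ∈ V') : fourth u v ∉ V' := by
  intro hy'
  have hx := third_notMem hf hV hu hv hv' hadj
  have hvx := adj_third hadj
  have hxy := adj_third hvx
  have hyu := adj_third hxy
  have hyv := third_ne hvx
  rw [third_third] at hxy hyu hyv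
  rw [third_fourth] at hyu
  have h1 : u = f v := by
    rcases hf u v (hV hu) hv' hadj with h | h | h
    · exact absurd h.2 hv
    · exact absurd hu h.1
    · exact h.2
  have h2 : v = f (third u v) := by
    rcases hf v _ hv' hx' hvx with h | h | h
    · exact absurd h.1 hv
    · exact absurd (h.2.trans h1.symm) (third_ne hadj)
    · exact h.2
  have h3 : fourth u v ∉ V ∧ third u v = f (fourth u v) := by
    rcases hf _ _ hx' hy' hxy with h | h | h
    · exact absurd h.1 hx
    · exact absurd (h.2.trans h2.symm) hyv
    · exact h
  rcases hf _ _ hy' (hV hu) hyu with h | h | h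
  · exact h3.1 h.1
  · exact third_ne hadj (h3.2.trans h.2.symm)
  · exact h.1 hu

lemma weight_mono (hV : V ⊆ V') (a : (ℤ × ℤ) × (ℤ × ℤ)) : weight V a ≤ weight V' a := by
  unfold weight
  refine Nat.pow_le_pow_right (by norm_num) (Nat.add_le_add ?_ ?_)
  · by_cases h : third a.1 a.2 ∈ V
    · simp [h, hV h]
    · simp [h]
  · by_cases h : fourth a.1 a.2 ∈ V
    · simp [h, hV h]
    · simp [h]

/-- If `v` is new, `third u v` was not in `V`. Should it stay outside `V'`, the next exit counts `u`
in its place, besides `fourth u v`. Should it be new as well, `fourth u v` is outside and the weight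
jumps from 1 to 25. -/
lemma weight_le_weight_nextExit (hf : IsTreeGrowth V V' f) (hV : V ⊆ V') (hu : u ∈ V) (hv : v ∉ V)
    (hadj : squareLattice.Adj u v) :
    weight V (u, v) ≤ weight V' (nextExit V' (u, v)) ∧
      (v ∈ V' → 5 * weight V (u, v) ≤ weight V' (nextExit V' (u, v))) := by
  by_cases hv' : v ∈ V'
  · suffices h : 5 * weight V (u, v) ≤ weight V' (nextExit V' (u, v)) from
      ⟨by omega, fun _ => h⟩
    have hx := third_notMem hf hV hu hv hv' hadj
    by_cases hx' : third u v ∈ V'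
    · have hy : fourth u v ∉ V := fun h => fourth_notMem hf hV hu hv hv' hadj hx' (hV h)
      have : nextExit V' (u, v) = (third u v, fourth u v) := by simp [nextExit, hv', hx']
      rw [this]
      simp [weight, third_fourth, fourth_fourth, hV hu, hv', hx, hy]
    · have : nextExit V' (u, v) = (v, third u v) := by simp [nextExit, hv', hx']
      rw [this]
      simp only [weight, third_third, fourth_third, hV hu, hx, if_true, if_false]
      by_cases hy : fourth u v ∈ V
      · simp [hy, hV hy]
      · split_ifs <;> norm_num
  · have : nextExit V' (u, v) = (u, v) := by simp [nextExit, hv']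
    rw [this]
    exact ⟨weight_mono hV _, fun h => absurd h hv'⟩

lemma nextExit_mem_exits {D : Finset (Sym2 (ℤ × ℤ))} (hf : IsTreeGrowth V V' f) (hV : V ⊆ V')
    (hD : ∀ e ∈ D, ∃ x ∈ V, x ∈ e) (h : (u, v) ∈ exits V D) :
    nextExit V' (u, v) ∈ exits V' D := by
  obtain ⟨hu, hv, hadj, hD'⟩ := mem_exits.1 h
  -- Every deleted edge meets the old cluster, so edges between vertices outside it are still
  -- intact.
  have hnew : ∀ a b, a ∉ V → b ∉ V → s(a, b) ∉ D := by
    intro a b ha hb hab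
    obtain ⟨x, hx, hxe⟩ := hD _ hab
    rcases Sym2.mem_iff.1 hxe with rfl | rfl
    · exact ha hx
    · exact hb hx
  by_cases hv' : v ∈ V'
  · have hx := third_notMem hf hV hu hv hv' hadj
    by_cases hx' : third u v ∈ V'
    · have hy' := fourth_notMem hf hV hu hv hv' hadj hx'
      have : nextExit V' (u, v) = (third u v, fourth u v) := by simp [nextExit, hv', hx']
      rw [this, mem_exits]
      have hxy := adj_third (adj_third hadj)
      rw [third_third] at hxy
      exact ⟨hx', hy', hxy, hnew _ _ hx fun h => hy' (hV h)⟩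
    · have : nextExit V' (u, v) = (v, third u v) := by simp [nextExit, hv', hx']
      rw [this, mem_exits]
      exact ⟨hv', hx', adj_third hadj, hnew _ _ hv hx⟩
  · have : nextExit V' (u, v) = (u, v) := by simp [nextExit, hv']
    rw [this, mem_exits]
    exact ⟨hV hu, hv', hadj, hD'⟩

/-- An exit and its image run around the same left square, the image zero, one or two corners
further on. Equal images thus share the square, and unequal shifts are excluded by which corners lie
in `V`. -/
lemma nextExit_injOn (D : Finset (Sym2 (ℤ × ℤ))) (hf : IsTreeGrowth V V' f) (hV : V ⊆ V') :
    Set.InjOn (nextExit V') (exits V D) := by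
  have key : ∀ a ∈ exits V D, nextExit V' a = a ∨
      nextExit V' a = (a.2, third a.1 a.2) ∧ third a.1 a.2 ∉ V ∨
      nextExit V' a = (third a.1 a.2, fourth a.1 a.2) ∧ third a.1 a.2 ∉ V := by
    rintro ⟨u, v⟩ ha
    obtain ⟨hu, hv, hadj, -⟩ := mem_exits.1 ha
    by_cases hv' : v ∈ V'
    · have hx := third_notMem hf hV hu hv hv' hadj
      by_cases hx' : third u v ∈ V' <;> simp [nextExit, hv', hx', hx]
    · simp [nextExit, hv']
  rintro ⟨u, v⟩ h1 ⟨s, t⟩ h2 he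
  rw [Finset.mem_coe] at h1 h2
  have k1 := key _ h1
  have k2 := key _ h2
  obtain ⟨hu, hv, -, -⟩ := mem_exits.1 h1
  obtain ⟨hs, ht, -, -⟩ := mem_exits.1 h2
  simp only at k1 k2
  rcases k1 with k1 | ⟨k1, k1'⟩ | ⟨k1, k1'⟩ <;> rcases k2 with k2 | ⟨k2, k2'⟩ | ⟨k2, k2'⟩ <;>
    rw [k1, k2] at he <;> obtain ⟨e1, e2⟩ := Prod.mk.inj he
  · exact he
  · exact absurd (e1 ▸ hu) ht
  · exact absurd (e1 ▸ hu) k2'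
  · exact absurd (e1 ▸ hs) hv
  · have := fourth_third u v
    rw [e2, e1, fourth_third] at this
    rw [this, e1]
  · have h5 := fourth_fourth s t
    rw [← e1, ← e2, fourth_third] at h5
    exact absurd (h5 ▸ hu) ht
  · exact absurd (e1 ▸ hs) k1'
  · have h5 := fourth_fourth u v
    rw [e1, e2, fourth_third] at h5
    exact absurd (h5 ▸ hs) hv
  · have h4 := third_fourth u v
    rw [e1, e2, third_fourth] at h4
    have h5 := fourth_fourth u v
    rw [e1, e2, fourth_fourth] at h5
    rw [h4, h5]

end NextExit

/-! ### Keeping the heaviest elements -/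

section Selection

variable {α : Type*} [DecidableEq α]

/-- Removing light elements from a set does not decrease its weight, if each missing element counts
as much as the lightest present element. -/
lemma exists_subset_heavy (ω : α → ℕ) (K : Finset α) (N m i : ℕ) (hm : ∀ a ∈ K, m ≤ ω a)
    (hi : i < K.card) (hN : K.card ≤ N) :
    ∃ K' ⊆ K, K'.card = K.card - i ∧ ∃ m', (∀ a ∈ K', m' ≤ ω a) ∧
      ∑ a ∈ K, ω a + (N - K.card) * m ≤ ∑ a ∈ K', ω a + (N - K'.card) * m' := by
  induction i with
  | zero => exact ⟨K, subset_rfl, rfl, m, hm, le_rfl⟩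
  | succ i ih =>
    obtain ⟨K', hK', hc, m', hm', hle⟩ := ih (by omega)
    obtain ⟨a, ha, hmin⟩ := K'.exists_min_image ω (Finset.card_pos.1 (by omega))
    refine ⟨K'.erase a, (Finset.erase_subset _ _).trans hK', ?_, ω a, fun b hb =>
      hmin b (Finset.mem_of_mem_erase hb), ?_⟩
    · rw [Finset.card_erase_of_mem ha]
      omega
    · have h1 := Finset.add_sum_erase K' ω ha
      have h2 : N - (K'.erase a).card = (N - K'.card) + 1 := by
        rw [Finset.card_erase_of_mem ha]
        omega
      -- Dropping the lightest `a` creates one more missing place worth `ω a`, which balances the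
      -- loss; the other missing places are revalued from `m'` up to `ω a`.
      have h3 : (N - K'.card) * m' ≤ (N - K'.card) * ω a := Nat.mul_le_mul_left _ (hm' a ha)
      rw [h2, add_mul]
      omega

end Selection

end PercolationGame

/-! ### Positions, progress and a single round -/

namespace PercolationGame

/-- The positions that Breaker reaches by always deleting edges that touch the cluster of `v₀`:
`S` and `D` are the sets of safe and deleted edges after `n` rounds, and `V` is the cluster. -/
structure IsPosition (v₀ : ℤ × ℤ) (p q n : ℕ) (S D : Finset (Sym2 (ℤ × ℤ)))
    (V : Finset (ℤ × ℤ)) : Prop where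
  cluster : IsCluster v₀ S V
  safe_mem : ∀ e ∈ S, e ∈ squareLattice.edgeSet
  deleted_mem : ∀ e ∈ D, e ∈ squareLattice.edgeSet
  disjoint : Disjoint S D
  card_safe : S.card = n * p
  card_deleted : D.card = n * q
  touch : ∀ e ∈ D, ∃ x ∈ V, x ∈ e

/-- The number of independent cycles in the subgraph induced on `V`, when it is connected. -/
def cycleRank (V : Finset (ℤ × ℤ)) : ℕ := (innerEdges V).card + 1 - V.card

/-- The number of Maker's edges after `n` rounds that do not contribute to the cluster `V`. -/
def waste (p n : ℕ) (V : Finset (ℤ × ℤ)) : ℕ := n * p + 1 - V.card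

/-- Breaker has made progress: `n` is bounded in terms of the cycle rank of the cluster, the
weights of the exits, and the waste. An exit that is missing for the maximal possible number counts
as much as the lightest one present. -/
def HasProgress (p n : ℕ) (V : Finset (ℤ × ℤ)) (D : Finset (Sym2 (ℤ × ℤ))) : Prop :=
  ∃ m, (∀ a ∈ exits V D, m ≤ weight V a) ∧
    n ≤ 2 * (101 * cycleRank V + (∑ a ∈ exits V D, weight V a +
      (4 - cycleRank V - (exits V D).card) * m)) + waste p n V

section

variable {v₀ : ℤ × ℤ} {p q n : ℕ} {S D M : Finset (Sym2 (ℤ × ℤ))} {V V' : Finset (ℤ × ℤ)}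

lemma IsCluster.cycleRank_add_card (h : IsCluster v₀ S V)
    (hS : ∀ e ∈ S, e ∈ squareLattice.edgeSet) :
    cycleRank V + V.card = (innerEdges V).card + 1 := by
  have h1 := h.card_le_card_inner_safe hS
  have h2 := Finset.card_le_card (Finset.inter_subset_right (s₁ := S) (s₂ := innerEdges V))
  unfold cycleRank
  omega

namespace IsPosition

lemma waste_add_card (h : IsPosition v₀ p q n S D V) : waste p n V + V.card = n * p + 1 := by
  have := h.cluster.card_le h.safe_mem
  rw [h.card_safe] at this
  unfold waste
  omega

/-- The ratio of `q` to `p` enters here: after substituting for `V.card` through the waste, the `2 *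
(n * p)` deletions cancel the growth in `n`. -/
lemma card_exits_add_le (h : IsPosition v₀ p q n S D V) (hpq : 2 * p ≤ q) :
    (exits V D).card + cycleRank V + 2 * waste p n V ≤ 4 := by
  have h1 := h.cluster.card_exits_add_le h.safe_mem h.deleted_mem h.disjoint h.touch
  have h2 := h.cluster.cycleRank_add_card h.safe_mem
  have h3 := h.waste_add_card
  have h4 : n * (2 * p) ≤ n * q := Nat.mul_le_mul_left n hpq
  have h5 : n * (2 * p) = 2 * (n * p) := by ring
  rw [h.card_deleted] at h1
  omega

/-- Breaker deletes all exits but those in `K`. -/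
lemma next (h : IsPosition v₀ p q n S D V) (hM : M.card = p)
    (hM' : ∀ e ∈ M, e ∈ squareLattice.edgeSet ∧ e ∉ S ∧ e ∉ D) (hV' : IsCluster v₀ (S ∪ M) V')
    {K : Finset ((ℤ × ℤ) × (ℤ × ℤ))} (hK : K ⊆ exits V' D) (hc : K.card + q = (exits V' D).card) :
    ∃ b : Finset (Sym2 (ℤ × ℤ)), b.card = q ∧
      (∀ e ∈ b, e ∈ squareLattice.edgeSet ∧ e ∉ S ∧ e ∉ D ∧ e ∉ M) ∧
      IsPosition v₀ p q (n + 1) (S ∪ M) (D ∪ b) V' ∧ exits V' (D ∪ b) = K := by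
  have hinj : Set.InjOn (fun a : (ℤ × ℤ) × (ℤ × ℤ) => s(a.1, a.2)) (exits V' D) :=
    (outDarts_mk_injOn V').mono (by exact_mod_cast Finset.filter_subset _ _)
  set b := (exits V' D \ K).image (fun a => s(a.1, a.2)) with hb
  have hcard : b.card = q := by
    rw [hb, Finset.card_image_of_injOn (hinj.mono (by exact_mod_cast Finset.sdiff_subset)),
      Finset.card_sdiff_of_subset hK]
    omega
  have hmem : ∀ e ∈ b, e ∈ squareLattice.edgeSet ∧ e ∉ S ∧ e ∉ D ∧ e ∉ M ∧ ∃ x ∈ V', x ∈ e := by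
    intro e he
    obtain ⟨⟨u, v⟩, ha, rfl⟩ := Finset.mem_image.1 he
    obtain ⟨hu, hv, hadj, hD⟩ := mem_exits.1 (Finset.mem_sdiff.1 ha).1
    have hS : s(u, v) ∉ S ∪ M := fun hS => hv (hV'.mem_of_edge hu hS)
    rw [Finset.mem_union, not_or] at hS
    exact ⟨hadj, hS.1, hD, hS.2, u, hu, by simp⟩
  refine ⟨b, hcard, fun e he => ?_, ?_, ?_⟩
  · obtain ⟨h1, h2, h3, h4, -⟩ := hmem e he
    exact ⟨h1, h2, h3, h4⟩
  · refine ⟨hV', ?_, ?_, ?_, ?_, ?_, ?_⟩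
    · intro e he
      rcases Finset.mem_union.1 he with he | he
      · exact h.safe_mem e he
      · exact (hM' e he).1
    · intro e he
      rcases Finset.mem_union.1 he with he | he
      · exact h.deleted_mem e he
      · exact (hmem e he).1
    · rw [Finset.disjoint_union_left, Finset.disjoint_union_right, Finset.disjoint_union_right]
      refine ⟨⟨h.disjoint, ?_⟩, ?_, ?_⟩
      · exact Finset.disjoint_right.2 fun e he => (hmem e he).2.1
      · exact Finset.disjoint_left.2 fun e he => (hM' e he).2.2
      · exact Finset.disjoint_right.2 fun e he => (hmem e he).2.2.2.1
    · rw [Finset.card_union_of_disjoint, h.card_safe, hM]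
      · ring
      · exact Finset.disjoint_right.2 fun e he => (hM' e he).2.1
    · rw [Finset.card_union_of_disjoint, h.card_deleted, hcard]
      · ring
      · exact Finset.disjoint_right.2 fun e he => (hmem e he).2.2.1
    · intro e he
      rcases Finset.mem_union.1 he with he | he
      · obtain ⟨x, hx, hxe⟩ := h.touch e he
        exact ⟨x, h.cluster.subset hV' Finset.subset_union_left hx, hxe⟩
      · exact (hmem e he).2.2.2.2
  · ext ⟨u, v⟩
    constructor
    · intro ha
      obtain ⟨hu, hv, hadj, hD⟩ := mem_exits.1 ha
      rw [Finset.mem_union, not_or] at hD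
      by_contra hK'
      refine hD.2 (Finset.mem_image.2 ⟨(u, v), Finset.mem_sdiff.2 ⟨?_, hK'⟩, rfl⟩)
      exact mem_exits.2 ⟨hu, hv, hadj, hD.1⟩
    · intro ha
      obtain ⟨hu, hv, hadj, hD⟩ := mem_exits.1 (hK ha)
      refine mem_exits.2 ⟨hu, hv, hadj, ?_⟩
      rw [Finset.mem_union, not_or]
      refine ⟨hD, fun hb' => ?_⟩
      obtain ⟨a', ha', he⟩ := Finset.mem_image.1 hb'
      rw [Finset.mem_sdiff] at ha'
      exact ha'.2 (hinj ha'.1 (hK ha) he ▸ ha)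

/-- If the cycle rank of the cluster stays the same, then Breaker can keep exits of large weight. -/
lemma exists_heavy_exits (h : IsPosition v₀ p q n S D V) (hp : 0 < p) (hpq : 2 * p ≤ q)
    (hne : (exits V D).Nonempty) (hprog : HasProgress p n V D)
    (hM' : ∀ e ∈ M, e ∈ squareLattice.edgeSet ∧ e ∉ S ∧ e ∉ D)
    (hV' : IsCluster v₀ (S ∪ M) V') (hrank : cycleRank V' = cycleRank V)
    {f : ℤ × ℤ → ℤ × ℤ} (hf : IsTreeGrowth V V' f) (hlt : q < (exits V' D).card) :
    ∃ K ⊆ exits V' D, K.card + q = (exits V' D).card ∧ ∃ m, (∀ a ∈ K, m ≤ weight V' a) ∧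
      n + 1 ≤ 2 * (101 * cycleRank V' + (∑ a ∈ K, weight V' a +
        (4 - cycleRank V' - K.card) * m)) + waste p (n + 1) V' := by
  obtain ⟨m, hm, hn⟩ := hprog
  have hV := h.cluster.subset hV' Finset.subset_union_left
  have hcount := h.card_exits_add_le hpq
  have hw := h.waste_add_card
  have hpos := Finset.card_pos.2 hne
  set K₁ := (exits V D).image (nextExit V') with hK₁
  have hinj := nextExit_injOn D hf hV
  have hcard : K₁.card = (exits V D).card := Finset.card_image_of_injOn hinj
  have hsum : ∑ a ∈ K₁, weight V' a = ∑ a ∈ exits V D, weight V' (nextExit V' a) :=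
    Finset.sum_image hinj
  have hsub : K₁ ⊆ exits V' D := by
    intro a ha
    obtain ⟨⟨u, v⟩, hb, rfl⟩ := Finset.mem_image.1 ha
    exact nextExit_mem_exits hf hV h.touch hb
  have hle : ∀ a ∈ exits V D, weight V a ≤ weight V' (nextExit V' a) := by
    rintro ⟨u, v⟩ ha
    obtain ⟨hu, hv, hadj, -⟩ := mem_exits.1 ha
    exact (weight_le_weight_nextExit hf hV hu hv hadj).1
  have hm₁ : ∀ a ∈ K₁, m ≤ weight V' a := by
    intro a ha
    obtain ⟨b, hb, rfl⟩ := Finset.mem_image.1 ha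
    exact (hm b hb).trans (hle b hb)
  have hsle := Finset.sum_le_sum hle
  -- A gain of 1 is doubled in `HasProgress`, which pays for the new round and for losing the old
  -- waste, at most 1.
  have hstep : (V' = V ∧ waste p (n + 1) V' = waste p n V + p) ∨
      (∑ a ∈ exits V D, weight V a + (4 - cycleRank V - (exits V D).card) * m + 1 ≤
        ∑ a ∈ K₁, weight V' a) := by
    by_cases hVV : V' ⊆ V
    · left
      have heq := Finset.Subset.antisymm hVV hV
      refine ⟨heq, ?_⟩
      rw [heq]
      have : (n + 1) * p = n * p + p := by ring
      unfold waste at hw ⊢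
      omega
    · right
      obtain ⟨u, v, hu, hv', hv, he⟩ := h.cluster.exists_crossing hV' hVV
      have heS : s(u, v) ∉ S := fun hS => hv (h.cluster.mem_of_edge hu hS)
      have heM := hM' _ ((Finset.mem_union.1 he).resolve_left heS)
      have hadj : squareLattice.Adj u v := heM.1
      have ha : (u, v) ∈ exits V D := mem_exits.2 ⟨hu, hv, hadj, heM.2.2⟩
      -- The factor 5 is spent as `1 + 3 + 1`: the old weight of this exit, at most three missing
      -- exits worth no more than it, and a gain of 1.
      have h5 := (weight_le_weight_nextExit hf hV hu hv hadj).2 hv'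
      have h1 := hm _ ha
      have h2 := one_le_weight V (u, v)
      have h3 : (4 - cycleRank V - (exits V D).card) * m ≤ 3 * weight V (u, v) :=
        Nat.mul_le_mul (by omega) h1
      have e1 := Finset.add_sum_erase _ (fun a => weight V a) ha
      have e2 := Finset.add_sum_erase _ (fun a => weight V' (nextExit V' a)) ha
      have e3 := Finset.sum_le_sum fun a (ha : a ∈ (exits V D).erase (u, v)) =>
        hle a (Finset.mem_of_mem_erase ha)
      rw [hsum]
      omega
  by_cases hj : (exits V' D).card - q ≤ K₁.card
  · obtain ⟨K, hK, hKc, m', hm', hle'⟩ := exists_subset_heavy (weight V') K₁ (4 - cycleRank V) m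
      (K₁.card - ((exits V' D).card - q)) hm₁ (by omega) (by omega)
    refine ⟨K, hK.trans hsub, by omega, m', hm', ?_⟩
    rw [hcard, hsum] at hle'
    rw [hrank]
    rcases hstep with ⟨-, hs⟩ | hs
    · omega
    · rw [hsum] at hs
      omega
  -- More exits stay open than before, which forces `V' ≠ V`. All images are kept, and their weights
  -- already exceed the old total with its missing places, so `m = 0` suffices.
  · obtain ⟨K, hK, hK', hKc⟩ := Finset.exists_subsuperset_card_eq hsub
      (n := (exits V' D).card - q) (by omega) (by omega)
    refine ⟨K, hK', by omega, 0, fun _ _ => Nat.zero_le _, ?_⟩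
    rw [hrank]
    rcases hstep with ⟨heq, -⟩ | hs
    · subst heq
      omega
    · have : ∑ a ∈ K₁, weight V' a ≤ ∑ a ∈ K, weight V' a := Finset.sum_le_sum_of_subset hK
      omega

/-- One round of the game: Breaker has an answer to `M` after which the cluster has no exits, or
he makes progress. -/
lemma exists_answer (h : IsPosition v₀ p q n S D V) (hp : 0 < p) (hpq : 2 * p ≤ q)
    (hne : (exits V D).Nonempty) (hprog : HasProgress p n V D)
    (hM : M.card = p) (hM' : ∀ e ∈ M, e ∈ squareLattice.edgeSet ∧ e ∉ S ∧ e ∉ D)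
    (hV' : IsCluster v₀ (S ∪ M) V') (hlt : q < (exits V' D).card) :
    ∃ b : Finset (Sym2 (ℤ × ℤ)), b.card = q ∧
      (∀ e ∈ b, e ∈ squareLattice.edgeSet ∧ e ∉ S ∧ e ∉ D ∧ e ∉ M) ∧
      IsPosition v₀ p q (n + 1) (S ∪ M) (D ∪ b) V' ∧ (exits V' (D ∪ b)).Nonempty ∧
      HasProgress p (n + 1) V' (D ∪ b) := by
  suffices hK : ∃ K ⊆ exits V' D, K.card + q = (exits V' D).card ∧
      ∃ m, (∀ a ∈ K, m ≤ weight V' a) ∧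
      n + 1 ≤ 2 * (101 * cycleRank V' + (∑ a ∈ K, weight V' a +
        (4 - cycleRank V' - K.card) * m)) + waste p (n + 1) V' by
    obtain ⟨K, hK, hc, m, hm, hn⟩ := hK
    obtain ⟨b, hb, hb', hpos, hex⟩ := h.next hM hM' hV' hK hc
    refine ⟨b, hb, hb', hpos, ?_, m, ?_, ?_⟩
    · rw [hex]
      exact Finset.card_pos.1 (by omega)
    · rwa [hex]
    · rwa [hex]
  have hS' : ∀ e ∈ S ∪ M, e ∈ squareLattice.edgeSet := by
    intro e he
    rcases Finset.mem_union.1 he with he | he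
    · exact h.safe_mem e he
    · exact (hM' e he).1
  obtain ⟨g1, g2⟩ := h.cluster.growth hV' Finset.subset_union_left hS'
  have c1 := h.cluster.cycleRank_add_card h.safe_mem
  have c2 := hV'.cycleRank_add_card hS'
  by_cases hrank : cycleRank V' = cycleRank V
  · obtain ⟨f, hf⟩ := g2 (by omega)
    exact h.exists_heavy_exits hp hpq hne hprog hM' hV' hrank hf hlt
  · obtain ⟨m, hm, hn⟩ := hprog
    -- When the cycle rank rises, any choice of exits will do, with `m = 0`.
    obtain ⟨K, hK, hKc⟩ := Finset.exists_subset_card_eq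
      (show (exits V' D).card - q ≤ (exits V' D).card by omega)
    refine ⟨K, hK, by omega, 0, fun _ _ => Nat.zero_le _, ?_⟩
    obtain ⟨a, ha⟩ := hne
    have hm25 := (hm a ha).trans (weight_le V a)
    have hcount := h.card_exits_add_le hpq
    have hpos : 1 ≤ (exits V D).card := Finset.card_pos.2 ⟨_, ha⟩
    have h1 : ∑ a ∈ exits V D, weight V a ≤ (exits V D).card * 25 :=
      Finset.sum_le_card_nsmul _ _ _ fun a _ => weight_le V a
    have h2 : (4 - cycleRank V - (exits V D).card) * m ≤
        (4 - cycleRank V - (exits V D).card) * 25 := Nat.mul_le_mul_left _ hm25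
    -- Old exits and missing places are worth at most `4 * 25 = 100` and the waste is at most 1, so
    -- `n + 1 ≤ 2 * (101 * cycleRank V + 101)`; this is why a cycle counts 101.
    omega

lemma rounds_le (h : IsPosition v₀ p q n S D V) (hpq : 2 * p ≤ q) (hne : (exits V D).Nonempty)
    (hprog : HasProgress p n V D) : n ≤ 807 := by
  obtain ⟨m, hm, hn⟩ := hprog
  obtain ⟨a, ha⟩ := hne
  have hm25 := (hm a ha).trans (weight_le V a)
  have hcount := h.card_exits_add_le hpq
  have hpos : 1 ≤ (exits V D).card := Finset.card_pos.2 ⟨_, ha⟩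
  have h1 : ∑ a ∈ exits V D, weight V a ≤ (exits V D).card * 25 :=
    Finset.sum_le_card_nsmul _ _ _ fun a _ => weight_le V a
  have h2 : (4 - cycleRank V - (exits V D).card) * m ≤
      (4 - cycleRank V - (exits V D).card) * 25 := Nat.mul_le_mul_left _ hm25
  -- A crude bound: cycle rank at most 3, weights and missing places at most 100, waste at most 1,
  -- and `2 * (101 * 3 + 100) + 1 = 807`.
  omega

end IsPosition

end

end PercolationGame

/-! ### From positions to histories and a strategy -/

namespace PercolationGame

section

variable {V : Type*}

lemma safeEdges_append (h : List (Round V)) (m b : Finset (Sym2 V)) :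
    safeEdges (h ++ [(m, b)]) = safeEdges h ∪ m := by
  ext e
  simp [safeEdges, or_and_right, exists_or]

lemma deletedEdges_append (h : List (Round V)) (m b : Finset (Sym2 V)) :
    deletedEdges (h ++ [(m, b)]) = deletedEdges h ∪ b := by
  ext e
  simp [deletedEdges, or_and_right, exists_or]

lemma finite_safeEdges (h : List (Round V)) : (safeEdges h).Finite := by
  have : safeEdges h = ⋃ r ∈ {r | r ∈ h}, (r.1 : Set (Sym2 V)) := by
    ext e
    simp [safeEdges]
  rw [this]
  exact (List.finite_toSet h).biUnion fun r _ => r.1.finite_toSet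

lemma finite_deletedEdges (h : List (Round V)) : (deletedEdges h).Finite := by
  have : deletedEdges h = ⋃ r ∈ {r | r ∈ h}, (r.2 : Set (Sym2 V)) := by
    ext e
    simp [deletedEdges]
  rw [this]
  exact (List.finite_toSet h).biUnion fun r _ => r.2.finite_toSet

lemma length_history (σ : BreakerStrategy V) (m : ℕ → Finset (Sym2 V)) (n : ℕ) :
    (history σ m n).length = n := by
  induction n with
  | zero => rfl
  | succ n ih => simp [history, ih]

/-- On a graph with infinitely many edges, every small enough set of unclaimed edges extends to a
legal turn of Breaker. -/
lemma exists_isBreakerMove_superset {G : SimpleGraph V} (hG : G.edgeSet.Infinite) (q : ℕ)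
    (h : List (Round V)) (m T : Finset (Sym2 V)) (hT : T.card ≤ q)
    (hT' : (T : Set (Sym2 V)) ⊆ unclaimedEdges G h \ m) :
    ∃ b, T ⊆ b ∧ IsBreakerMove G q h m b := by
  classical
  have hinf : ((unclaimedEdges G h \ (m : Set (Sym2 V))) \ (T : Set (Sym2 V))).Infinite :=
    ((hG.sdiff ((finite_safeEdges h).union (finite_deletedEdges h))).sdiff m.finite_toSet).sdiff
      T.finite_toSet
  obtain ⟨t, ht, htc⟩ := hinf.exists_subset_card_eq (q - T.card)
  refine ⟨T ∪ t, Finset.subset_union_left, ?_, ?_⟩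
  · rw [Finset.card_union_of_disjoint, htc]
    · omega
    · exact Finset.disjoint_right.2 fun e he => (ht he).2
  · rw [Finset.coe_union]
    exact Set.union_subset hT' (ht.trans Set.sdiff_subset)

end

lemma infinite_edgeSet_squareLattice : squareLattice.edgeSet.Infinite := by
  refine Set.infinite_of_injective_forall_mem
    (f := fun n : ℤ => s(((n, 0) : ℤ × ℤ), ((n + 1, 0) : ℤ × ℤ))) ?_ ?_
  · intro a b hab
    have := Sym2.eq_iff.1 hab
    simp only [Prod.mk.injEq] at this
    omega
  · intro n
    change (n - (n + 1)) ^ 2 + ((0 : ℤ) - 0) ^ 2 = 1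
    ring

/-- Breaker has won when all the exits from the finite cluster are deleted. -/
lemma breakerHasWon_of_exits_eq_empty {v₀ : ℤ × ℤ} {V : Finset (ℤ × ℤ)}
    {D : Finset (Sym2 (ℤ × ℤ))} {h : List (Round (ℤ × ℤ))} (hv : v₀ ∈ V)
    (hD : (D : Set (Sym2 (ℤ × ℤ))) = deletedEdges h) (hex : exits V D = ∅) :
    BreakerHasWon squareLattice v₀ h := by
  refine V.finite_toSet.subset fun x hx => ?_
  rw [SimpleGraph.ConnectedComponent.mem_supp_iff, SimpleGraph.ConnectedComponent.eq] at hx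
  obtain ⟨w⟩ := hx.symm
  have key : ∀ a b : ℤ × ℤ, (squareLattice.deleteEdges (deletedEdges h)).Walk a b →
      a ∈ V → b ∈ V := by
    intro a b w
    induction w with
    | nil => exact id
    | @cons a c b hadj w ih =>
      intro ha
      refine ih ?_
      rw [SimpleGraph.deleteEdges_adj, ← hD] at hadj
      by_contra hc
      have : (a, c) ∈ exits V D := mem_exits.2 ⟨ha, hc, hadj.1, fun h => hadj.2 h⟩
      rw [hex] at this
      simp at this
  exact key _ _ w hv

/-- The histories on which Breaker has followed his strategy and has not yet won. -/
def IsGoodHistory (v₀ : ℤ × ℤ) (p q : ℕ) (h : List (Round (ℤ × ℤ))) : Prop :=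
  ∃ (S D : Finset (Sym2 (ℤ × ℤ))) (V : Finset (ℤ × ℤ)),
    (S : Set (Sym2 (ℤ × ℤ))) = safeEdges h ∧ (D : Set (Sym2 (ℤ × ℤ))) = deletedEdges h ∧
    IsPosition v₀ p q h.length S D V ∧ (exits V D).Nonempty ∧ HasProgress p h.length V D

lemma isGoodHistory_nil (v₀ : ℤ × ℤ) (p q : ℕ) : IsGoodHistory v₀ p q [] := by
  obtain ⟨V, hV⟩ := exists_isCluster v₀ ∅
  have hcard : V.card ≤ 1 := hV.card_le (by simp)
  refine ⟨∅, ∅, V, by simp [safeEdges], by simp [deletedEdges],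
    ⟨hV, by simp, by simp, by simp, by simp, by simp, by simp⟩, ?_, 0, by simp, by simp⟩
  have hadj : squareLattice.Adj v₀ (v₀.1 + 1, v₀.2) := by
    change (v₀.1 - (v₀.1 + 1)) ^ 2 + (v₀.2 - v₀.2) ^ 2 = 1
    ring
  refine ⟨(v₀, (v₀.1 + 1, v₀.2)), mem_exits.2 ⟨hV.root_mem, fun h => ?_, hadj, by simp⟩⟩
  exact hadj.ne (Finset.card_le_one.1 hcard _ hV.root_mem _ h)

lemma IsGoodHistory.exists_answer {v₀ : ℤ × ℤ} {p q : ℕ} {h : List (Round (ℤ × ℤ))}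
    (hh : IsGoodHistory v₀ p q h) (hp : 0 < p) (hpq : 2 * p ≤ q) {m : Finset (Sym2 (ℤ × ℤ))}
    (hm : IsMakerMove squareLattice p h m) :
    ∃ b, IsBreakerMove squareLattice q h m b ∧
      (BreakerHasWon squareLattice v₀ (h ++ [(m, b)]) ∨ IsGoodHistory v₀ p q (h ++ [(m, b)])) := by
  obtain ⟨S, D, V, hS, hD, hpos, hne, hprog⟩ := hh
  obtain ⟨V', hV'⟩ := exists_isCluster v₀ (S ∪ m)
  have hunclaimed : ∀ e, e ∈ unclaimedEdges squareLattice h ↔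
      e ∈ squareLattice.edgeSet ∧ e ∉ S ∧ e ∉ D := by
    intro e
    rw [unclaimedEdges, ← hS, ← hD, Set.mem_sdiff, Set.mem_union, not_or, Finset.mem_coe,
      Finset.mem_coe]
  have hm' : ∀ e ∈ m, e ∈ squareLattice.edgeSet ∧ e ∉ S ∧ e ∉ D :=
    fun e he => (hunclaimed e).1 (hm.2 he)
  by_cases hlt : q < (exits V' D).card
  · obtain ⟨b, hb, hb', hpos', hne', hprog'⟩ :=
      hpos.exists_answer hp hpq hne hprog hm.1 hm' hV' hlt
    refine ⟨b, ⟨hb, fun e he => ?_⟩, Or.inr ⟨S ∪ m, D ∪ b, V', ?_, ?_, ?_, hne', ?_⟩⟩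
    · obtain ⟨h1, h2, h3, h4⟩ := hb' e he
      exact ⟨(hunclaimed e).2 ⟨h1, h2, h3⟩, h4⟩
    · rw [safeEdges_append, Finset.coe_union, hS]
    · rw [deletedEdges_append, Finset.coe_union, hD]
    · simpa using hpos'
    · simpa using hprog'
  -- All exits fit into one turn; the rest of the `q` deletions are arbitrary.
  · obtain ⟨b, hTb, hb⟩ := exists_isBreakerMove_superset infinite_edgeSet_squareLattice q h m
      ((exits V' D).image fun a => s(a.1, a.2)) (Finset.card_image_le.trans (not_lt.1 hlt)) (by
        intro e he
        obtain ⟨⟨u, v⟩, ha, rfl⟩ := Finset.mem_image.1 (Finset.mem_coe.1 he)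
        obtain ⟨hu, hv, hadj, huD⟩ := mem_exits.1 ha
        have hSm : s(u, v) ∉ S ∪ m := fun hS => hv (hV'.mem_of_edge hu hS)
        rw [Finset.mem_union, not_or] at hSm
        exact ⟨(hunclaimed _).2 ⟨hadj, hSm.1, huD⟩, hSm.2⟩)
    refine ⟨b, hb, Or.inl (breakerHasWon_of_exits_eq_empty (D := D ∪ b) hV'.root_mem ?_ ?_)⟩
    · rw [deletedEdges_append, Finset.coe_union, hD]
    · rw [Finset.eq_empty_iff_forall_notMem]
      rintro ⟨u, v⟩ ha
      obtain ⟨hu, hv, hadj, huD⟩ := mem_exits.1 ha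
      rw [Finset.mem_union, not_or] at huD
      exact huD.2 (hTb (Finset.mem_image.2 ⟨(u, v), mem_exits.2 ⟨hu, hv, hadj, huD.1⟩, rfl⟩))

lemma IsGoodHistory.length_le {v₀ : ℤ × ℤ} {p q : ℕ} {h : List (Round (ℤ × ℤ))}
    (hh : IsGoodHistory v₀ p q h) (hpq : 2 * p ≤ q) : h.length ≤ 807 := by
  obtain ⟨S, D, V, -, -, hpos, hne, hprog⟩ := hh
  exact hpos.rounds_le hpq hne hprog

end PercolationGame

/-- For all positive integers `p`, `q` with `q ≥ 2p`, Breaker has a winning strategy in the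
`(p, q)`-percolation game on the square lattice, whichever vertex is chosen as the root. -/
theorem theorem3 (p q : ℕ) (hp : 0 < p) (hq : 0 < q) (hpq : 2 * p ≤ q) (v₀ : ℤ × ℤ) :
    PercolationGame.BreakerWins squareLattice v₀ p q := by
  open PercolationGame in
  have key : ∀ (h : List (Round (ℤ × ℤ))) (m : Finset (Sym2 (ℤ × ℤ))), ∃ b,
      IsMakerMove squareLattice p h m → IsBreakerMove squareLattice q h m b ∧
        (IsGoodHistory v₀ p q h → BreakerHasWon squareLattice v₀ (h ++ [(m, b)]) ∨
          IsGoodHistory v₀ p q (h ++ [(m, b)])) := by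
    intro h m
    by_cases hm : IsMakerMove squareLattice p h m
    · by_cases hh : IsGoodHistory v₀ p q h
      · obtain ⟨b, hb, hb'⟩ := hh.exists_answer hp hpq hm
        exact ⟨b, fun _ => ⟨hb, fun _ => hb'⟩⟩
      -- Outside good histories, for instance after a win, only legality matters.
      · obtain ⟨b, -, hb⟩ := exists_isBreakerMove_superset infinite_edgeSet_squareLattice q h m ∅
          (Nat.zero_le _) (by simp)
        exact ⟨b, fun _ => ⟨hb, fun h => absurd h hh⟩⟩
    · exact ⟨∅, fun h => absurd h hm⟩
  choose σ hσ using key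
  refine ⟨σ, fun m => ⟨fun n hn => (hσ _ _ (hn n le_rfl)).1, fun hm => ?_⟩⟩
  by_contra! hcon
  have hgood : ∀ n, PercolationGame.IsGoodHistory v₀ p q (PercolationGame.history σ m n) := by
    intro n
    induction n with
    | zero => exact PercolationGame.isGoodHistory_nil v₀ p q
    | succ n ih => exact ((hσ _ _ (hm n)).2 ih).resolve_left (hcon (n + 1))
  have := (hgood 808).length_le hpq
  rw [PercolationGame.length_history] at this
  omega
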